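/- Let $1\le q<p<\infty$, $\eta>0$, $\tau,\gamma>1$, $C_P>0$, $\lambda\ge 1$ and $C_A\in\mathbb R$. There is a constant $c>0$, depending only on $p,q,\eta,\tau,\gamma,C_P,\lambda,C_A$, such that the following holds. Let $X=(X,d,\mu)$ be a metric space equipped with a complete Borel measure $\mu$ (the completion of a measure on the Borel sets) such that $0<\mu(B)<\infty$ for all balls $B$. Let $x_0\in X$ and write $B_r=\{x\in X: d(x,x_0)<r\}$. Assume that (i) $X$ supports a $q$-Poincaré inequality at $x_0$: for all $r>0$, all integrable functions $f$ on $X$ and all upper gradients $g$ of $f$, $$\frac1{\mu(B_r)}\int_{B_r}|f-f_{B_r}|\,d\mu\le C_P\,r\Bigl(\frac1{\mu(B_{\lambda r})}\int_{B_{\lambda r}}g^q\,d\mu\Bigr)^{1/q},\qquad f_{B_r}=\frac1{\mu(B_r)}\int_{B_r}f\,d\mu;$$ (ii) $\mu$ has the $\eta$-annular decay property at $x_0$: $\mu(B_R\setminus B_r)\le C_A(1-r/R)^\eta\mu(B_R)$ for all $0<r<R$; (iii) $\mu$ is reverse-doubling at $x_0$ with dilation $\tau$: $\mu(B_{\tau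 r})\ge\gamma\mu(B_r)$ for all $0<r\le \operatorname{diam}X/(2\tau)$. Then $$\operatorname{cap}_p(B_r,B_R)\ \ge\ c\Bigl(1-\frac rR\Bigr)^{\eta(q-p)/q}\,\frac{\mu(B_R)}{R^p}\qquad\text{whenever } 0<\frac R2\le r<R\le\frac{\operatorname{diam}X}{2\tau}.$$ Here curves are nonconstant, compact and rectifiable, parameterized by arc length. A Borel function $g:X\to[0,\infty]$ is an upper gradient of $f$ if $|f(\sigma(0))-f(\sigma(l_\sigma))|\le\int_\sigma g\,ds$ for all curves $\sigma:[0,l_\sigma]\to X$; a measurable $g:X\to[0,\infty]$ is a $p$-weak upper gradient of $f$ if this holds for all curves outside a family $\Gamma$ for which there is $0\le\rho\in L^p(X)$ with $\int_\sigma\rho\,ds=\infty$ for all $\sigma\in\Gamma$. The space $N^{1,p}(X)$ consists of the (everywhere defined) measurable $f$ with $\int_X|f|^p\,d\mu+\inf_g\int_X g^p\,d\mu<\infty$, the infimum being over all upper gradients $g$ of $f$. For $E\subset\Omega$ with $\Omega$ open, $$\operatorname{cap}_p(E,\Omega)=\inf_u\int_\Omega g_u^p\,d\mu,$$ where $g_u$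 is the minimal $p$-weak upper gradient of $u$ (the a.e. smallest among the $p$-weak upper gradients of $u$ in $L^p(X)$), and the infimum is over all $u\in N^{1,p}(X)$ such that $\chi_E\le u\le1$ in $\Omega$ and $u=0$ on $X\setminus\Omega$. -/

import Mathlib

open MeasureTheory Set
open scoped ENNReal

namespace ThinAnnuli

noncomputable section

/-- A nonconstant compact rectifiable curve in `X`, parameterized by arc length on `[0, length]`
(the values of `toFun` outside `[0, length]` play no role). -/
structure RectifiableCurve (X : Type*) [MetricSpace X] where
  length : ℝ
  length_pos : 0 < length
  toFun : ℝ → X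
  unitSpeed : HasUnitSpeedOn toFun (Icc 0 length)

/-- The line integral `∫_γ g ds` of a nonnegative function. -/
def lineIntegral {X : Type*} [MetricSpace X] (g : X → ℝ≥0∞) (γ : RectifiableCurve X) : ℝ≥0∞ :=
  ∫⁻ t in Icc 0 γ.length, g (γ.toFun t)

/-- The upper gradient inequality `|f(γ(0)) - f(γ(l))| ≤ ∫_γ g ds` along one curve. -/
def UpperGradientIneq {X : Type*} [MetricSpace X] (f : X → ℝ) (g : X → ℝ≥0∞)
    (γ : RectifiableCurve X) : Prop :=
  ENNReal.ofReal |f (γ.toFun 0) - f (γ.toFun γ.length)| ≤ lineIntegral g γ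

/-- A Borel function `g : X → [0, ∞]` is an upper gradient of `f`. -/
def IsUpperGradient {X : Type*} [MetricSpace X] [MeasurableSpace X]
    (f : X → ℝ) (g : X → ℝ≥0∞) : Prop :=
  Measurable g ∧ ∀ γ : RectifiableCurve X, UpperGradientIneq f g γ

/-- A curve family has zero `p`-modulus: some nonnegative `ρ ∈ L^p(X)` has infinite integral
along every curve of the family. -/
def ZeroModulus {X : Type*} [MetricSpace X] [MeasurableSpace X] (μ : Measure X) (p : ℝ)
    (Γ : Set (RectifiableCurve X)) : Prop :=
  ∃ ρ : X → ℝ≥0∞, Measurable ρ ∧ ∫⁻ x, ρ x ^ p ∂μ < ∞ ∧ ∀ γ ∈ Γ, lineIntegral ρ γ = ∞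

/-- `g` is a `p`-weak upper gradient of `f`: it is measurable (with respect to the completion
of `μ`) and the upper gradient inequality fails only on a family of zero `p`-modulus. -/
def IsWeakUpperGradient {X : Type*} [MetricSpace X] [MeasurableSpace X] (μ : Measure X) (p : ℝ)
    (f : X → ℝ) (g : X → ℝ≥0∞) : Prop :=
  AEMeasurable g μ ∧ ZeroModulus μ p {γ | ¬ UpperGradientIneq f g γ}

/-- The Newtonian norm
`‖f‖ = (∫ |f|^p dμ + inf_g ∫ g^p dμ)^(1/p)`, the infimum being over the upper gradients of `f`. -/
def newtonianNorm {X : Type*} [MetricSpace X] [MeasurableSpace X] (μ : Measure X) (p : ℝ)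
    (f : X → ℝ) : ℝ≥0∞ :=
  (∫⁻ x, ENNReal.ofReal |f x| ^ p ∂μ
    + ⨅ (g : X → ℝ≥0∞) (_ : IsUpperGradient f g), ∫⁻ x, g x ^ p ∂μ) ^ (1 / p)

/-- Membership in the Newtonian space `N^{1,p}(X)` (functions are defined everywhere). -/
def MemNewtonian {X : Type*} [MetricSpace X] [MeasurableSpace X] (μ : Measure X) (p : ℝ)
    (f : X → ℝ) : Prop :=
  AEMeasurable f μ ∧ newtonianNorm μ p f < ∞

/-- `∫_Ω g_u^p dμ` for the minimal `p`-weak upper gradient `g_u` of `u`. As `g_u` is itself a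
`p`-weak upper gradient in `L^p(X)` and is a.e. below every other one, this is the infimum of
`∫_Ω g^p dμ` over all `p`-weak upper gradients `g ∈ L^p(X)` of `u`. -/
def energy {X : Type*} [MetricSpace X] [MeasurableSpace X] (μ : Measure X) (p : ℝ)
    (Ω : Set X) (u : X → ℝ) : ℝ≥0∞ :=
  ⨅ (g : X → ℝ≥0∞) (_ : IsWeakUpperGradient μ p u g ∧ ∫⁻ x, g x ^ p ∂μ < ∞),
    ∫⁻ x in Ω, g x ^ p ∂μ

/-- `u` is admissible for `cap_p(E, Ω)`: `u ∈ N^{1,p}(X)`, `χ_E ≤ u ≤ 1` in `Ω`, and `u = 0`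
on `X \ Ω`. -/
def IsAdmissible {X : Type*} [MetricSpace X] [MeasurableSpace X] (μ : Measure X) (p : ℝ)
    (E Ω : Set X) (u : X → ℝ) : Prop :=
  MemNewtonian μ p u ∧ (∀ x ∈ Ω, E.indicator 1 x ≤ u x ∧ u x ≤ 1) ∧ ∀ x ∉ Ω, u x = 0

/-- The variational `p`-capacity `cap_p(E, Ω)`. -/
def variationalCapacity {X : Type*} [MetricSpace X] [MeasurableSpace X] (μ : Measure X) (p : ℝ)
    (E Ω : Set X) : ℝ≥0∞ :=
  ⨅ (u : X → ℝ) (_ : IsAdmissible μ p E Ω u), energy μ p Ω u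

/-- The `η`-annular decay property at `x`, with constant `C`. -/
def AnnularDecayAt {X : Type*} [MetricSpace X] [MeasurableSpace X] (μ : Measure X) (x : X)
    (η C : ℝ) : Prop :=
  ∀ r R : ℝ, 0 < r → r < R →
    μ (Metric.ball x R \ Metric.ball x r)
      ≤ ENNReal.ofReal (C * (1 - r / R) ^ η) * μ (Metric.ball x R)

/-- The measure is reverse-doubling at `x`, with dilation `τ` and constant `γ`; the diameter
of `X` may be infinite. -/
def ReverseDoublingAt {X : Type*} [MetricSpace X] [MeasurableSpace X] (μ : Measure X) (x : X)
    (τ γ : ℝ) : Prop :=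
  ∀ r : ℝ, 0 < r → ENNReal.ofReal r ≤ Metric.ediam (univ : Set X) / ENNReal.ofReal (2 * τ) →
    ENNReal.ofReal γ * μ (Metric.ball x r) ≤ μ (Metric.ball x (τ * r))

/-- `X` supports a `q`-Poincaré inequality at `x`, with constant `C` and dilation `lam`. -/
def PoincareAt {X : Type*} [MetricSpace X] [MeasurableSpace X] (μ : Measure X) (x : X)
    (q C lam : ℝ) : Prop :=
  ∀ r : ℝ, 0 < r → ∀ (f : X → ℝ) (g : X → ℝ≥0∞), Integrable f μ → IsUpperGradient f g →
    ENNReal.ofReal (⨍ y in Metric.ball x r, |f y - ⨍ z in Metric.ball x r, f z ∂μ| ∂μ)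
      ≤ ENNReal.ofReal (C * r) * (⨍⁻ y in Metric.ball x (lam * r), g y ^ q ∂μ) ^ (1 / q)

end

end ThinAnnuli

namespace ThinAnnuli

/-! Test the Poincaré inequality on `B_{τR}` with an admissible `u`. Reverse doubling makes the
average of `u` at most `1/γ`, while `u = 1` on `B_r`, a fixed fraction of `B_{τR}` because annular
decay implies doubling (`exists_doubling_of_annularDecay`); so the mean oscillation is bounded below
(`le_average_abs_sub_average`). On the other side `u` is constant off the annulus `A = B_R \ B_r`,
so only `g` on `A` counts (`PoincareAt.average_le`). Hölder on `A` costs `μ(A)^(1/q - 1/p)`, which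
annular decay bounds, and the `p`-th power gives the exponent of `1 - r/R`.

The Poincaré inequality requires genuine upper gradients, whereas `g` is only weak. For every `ε >
0`, adding `ε(g + ρ)` to `χ_A g` gives a genuine one (`isUpperGradient_indicator_add`), and `ε → 0`
is harmless. -/

/-! ### Curves and truncation of weak upper gradients -/

/-- The restriction of a curve to a nondegenerate subinterval `[s, t]`. -/
def RectifiableCurve.subcurve {X : Type*} [MetricSpace X] (σ : RectifiableCurve X) {s t : ℝ}
    (hs : 0 ≤ s) (hst : s < t) (ht : t ≤ σ.length) : RectifiableCurve X where
  length := t - s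
  length_pos := sub_pos.2 hst
  toFun := fun x => σ.toFun (x + s)
  unitSpeed := by
    intro x hx y hy
    have h := σ.unitSpeed (x := x + s) ⟨by linarith [hx.1], by linarith [hx.2]⟩
      (y := y + s) ⟨by linarith [hy.1], by linarith [hy.2]⟩
    have himg : (fun a : ℝ => a + s) '' (Icc 0 (t - s) ∩ Icc x y)
        = Icc 0 σ.length ∩ Icc (x + s) (y + s) := by
      ext z
      constructor
      · rintro ⟨a, ⟨⟨h1, h2⟩, h3, h4⟩, rfl⟩
        exact ⟨⟨by linarith, by linarith⟩, by linarith, by linarith⟩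
      · rintro ⟨⟨h1, h2⟩, h3, h4⟩
        exact ⟨z - s, ⟨⟨by linarith [hx.1], by linarith [hy.2]⟩, by linarith, by linarith⟩,
          by simp⟩
    have hmono : MonotoneOn (fun a : ℝ => a + s) (Icc 0 (t - s) ∩ Icc x y) :=
      fun a _ b _ hab => by simpa using hab
    change eVariationOn (σ.toFun ∘ fun a : ℝ => a + s) _ = _
    rw [eVariationOn.comp_eq_of_monotoneOn _ _ hmono, himg, h]
    congr 2
    ring

theorem lineIntegral_subcurve {X : Type*} [MetricSpace X] (g : X → ℝ≥0∞)
    (σ : RectifiableCurve X) {s t : ℝ} (hs : 0 ≤ s) (hst : s < t) (ht : t ≤ σ.length) :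
    lineIntegral g (σ.subcurve hs hst ht) = ∫⁻ x in Icc s t, g (σ.toFun x) := by
  have h := (measurePreserving_add_right volume s).setLIntegral_comp_preimage_emb
    (MeasurableEquiv.addRight s).measurableEmbedding (fun x => g (σ.toFun x)) (Icc s t)
  have hpre : (fun a : ℝ => a + s) ⁻¹' Icc s t = Icc 0 (t - s) := by
    ext x; simp [le_sub_iff_add_le]
  rw [hpre] at h
  exact h

theorem lineIntegral_mono {X : Type*} [MetricSpace X] {g h : X → ℝ≥0∞} (hgh : ∀ x, g x ≤ h x)
    (σ : RectifiableCurve X) : lineIntegral g σ ≤ lineIntegral h σ :=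
  lintegral_mono fun _ => hgh _

/-- A function whose increments are dominated by integrals of an integrable function is
continuous. -/
theorem continuousOn_of_increment_le_lintegral {v : ℝ → ℝ} {G : ℝ → ℝ≥0∞} {l : ℝ}
    (hG : ∫⁻ x in Icc 0 l, G x ≠ ∞)
    (hv : ∀ s t, 0 ≤ s → s < t → t ≤ l →
      ENNReal.ofReal |v s - v t| ≤ ∫⁻ x in Icc s t, G x) :
    ContinuousOn v (Icc 0 l) := by
  rw [Metric.continuousOn_iff]
  intro b hb ε hε
  obtain ⟨δ, hδ, hδG⟩ := exists_pos_setLIntegral_lt_of_measure_lt hG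
    (ENNReal.ofReal_pos.2 hε).ne'
  obtain ⟨d, hd, hdδ⟩ : ∃ d : ℝ, 0 < d ∧ ENNReal.ofReal d ≤ δ := by
    rcases eq_or_ne δ ∞ with h | h
    · exact ⟨1, one_pos, by simp [h]⟩
    · exact ⟨δ.toReal, ENNReal.toReal_pos hδ.ne' h, by rw [ENNReal.ofReal_toReal h]⟩
  have key : ∀ s t, 0 ≤ s → s < t → t ≤ l → t - s < d → |v s - v t| < ε := by
    intro s t hs hst ht htd
    have hsub : Icc s t ⊆ Icc 0 l := Icc_subset_Icc hs ht
    have h1 := hδG (Icc s t) (by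
      rw [Measure.restrict_apply measurableSet_Icc, inter_eq_left.2 hsub, Real.volume_Icc]
      exact ((ENNReal.ofReal_lt_ofReal_iff hd).2 htd).trans_le hdδ)
    rw [Measure.restrict_restrict measurableSet_Icc, inter_eq_left.2 hsub] at h1
    exact (ENNReal.ofReal_lt_ofReal_iff hε).1 ((hv s t hs hst ht).trans_lt h1)
  refine ⟨d, hd, fun a ha hab => ?_⟩
  rw [Real.dist_eq] at hab ⊢
  rcases lt_trichotomy a b with h | h | h
  · exact key a b ha.1 h hb.2 (by rw [abs_sub_comm] at hab; exact (le_abs_self _).trans_lt hab)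
  · simpa [h] using hε
  · rw [abs_sub_comm]
    exact key b a hb.1 h ha.2 ((le_abs_self _).trans_lt hab)

/-- A decrease of a continuous function is achieved while its values lie strictly between the
end values. -/
theorem decrease_le_lintegral_of_between {v : ℝ → ℝ} {G H : ℝ → ℝ≥0∞} {l : ℝ} (hl : 0 ≤ l)
    (hc : ContinuousOn v (Icc 0 l))
    (hv : ∀ s t, 0 ≤ s → s < t → t ≤ l →
      ENNReal.ofReal |v s - v t| ≤ ∫⁻ x in Icc s t, G x)
    (h0l : v l < v 0) (hGH : ∀ x ∈ Icc 0 l, v l < v x → v x < v 0 → G x ≤ H x) :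
    ENNReal.ofReal (v 0 - v l) ≤ ∫⁻ x in Icc 0 l, H x := by
  have hSc : IsCompact (Icc 0 l ∩ v ⁻¹' Ici (v 0)) :=
    isCompact_Icc.of_isClosed_subset (hc.preimage_isClosed_of_isClosed isClosed_Icc isClosed_Ici)
      inter_subset_left
  -- `a` is the last point with `v ≥ v 0`, and `b` the first point after it with `v ≤ v l`; on `(a,
  -- b)` the values lie strictly between `v l` and `v 0`.
  obtain ⟨a, ⟨ha, hva⟩, hamax⟩ := hSc.exists_isGreatest ⟨0, ⟨le_rfl, hl⟩, le_refl (v 0)⟩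
  have hTc : IsCompact (Icc a l ∩ v ⁻¹' Iic (v l)) :=
    isCompact_Icc.of_isClosed_subset ((hc.mono
      (Icc_subset_Icc_left ha.1)).preimage_isClosed_of_isClosed isClosed_Icc isClosed_Iic)
      inter_subset_left
  obtain ⟨b, ⟨hb, hvb⟩, hbmin⟩ := hTc.exists_isLeast ⟨l, ⟨ha.2, le_rfl⟩, le_refl (v l)⟩
  rw [mem_preimage, mem_Ici] at hva
  rw [mem_preimage, mem_Iic] at hvb
  have hab : a < b := lt_of_le_of_ne hb.1 (by rintro rfl; linarith)
  calc ENNReal.ofReal (v 0 - v l) ≤ ENNReal.ofReal |v a - v b| :=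
        ENNReal.ofReal_le_ofReal ((by linarith : v 0 - v l ≤ v a - v b).trans (le_abs_self _))
    _ ≤ ∫⁻ x in Icc a b, G x := hv a b ha.1 hab hb.2
    _ = ∫⁻ x in Ioo a b, G x := by rw [restrict_Ioo_eq_restrict_Icc]
    _ ≤ ∫⁻ x in Ioo a b, H x := by
        refine setLIntegral_mono' measurableSet_Ioo fun x hx => hGH x
          ⟨ha.1.trans hx.1.le, hx.2.le.trans hb.2⟩ ?_ ?_
        · by_contra! h
          exact absurd (hbmin ⟨⟨hx.1.le, hx.2.le.trans hb.2⟩, h⟩) (not_le.2 hx.2)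
        · by_contra! h
          exact absurd (hamax ⟨⟨ha.1.trans hx.1.le, hx.2.le.trans hb.2⟩, h⟩) (not_le.2 hx.1)
    _ ≤ ∫⁻ x in Icc 0 l, H x :=
        lintegral_mono_set (Ioo_subset_Icc_self.trans (Icc_subset_Icc ha.1 hb.2))

theorem increment_le_lintegral_of_between {v : ℝ → ℝ} {G H : ℝ → ℝ≥0∞} {l m M : ℝ} (hl : 0 ≤ l)
    (hc : ContinuousOn v (Icc 0 l))
    (hv : ∀ s t, 0 ≤ s → s < t → t ≤ l →
      ENNReal.ofReal |v s - v t| ≤ ∫⁻ x in Icc s t, G x)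
    (hmM : ∀ x, m ≤ v x ∧ v x ≤ M) (hGH : ∀ x ∈ Icc 0 l, m < v x → v x < M → G x ≤ H x) :
    ENNReal.ofReal |v 0 - v l| ≤ ∫⁻ x in Icc 0 l, H x := by
  rcases lt_trichotomy (v l) (v 0) with h | h | h
  · rw [abs_of_pos (sub_pos.2 h)]
    exact decrease_le_lintegral_of_between hl hc hv h fun x hx h1 h2 =>
      hGH x hx ((hmM l).1.trans_lt h1) (h2.trans_le (hmM 0).2)
  · simp [h]
  · have := decrease_le_lintegral_of_between (v := fun x => -v x) (G := G) (H := H) hl hc.neg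
      (fun s t hs hst ht => by
        have := hv s t hs hst ht
        rwa [neg_sub_neg, abs_sub_comm])
      (neg_lt_neg h) fun x hx h1 h2 =>
        hGH x hx ((hmM 0).1.trans_lt (neg_lt_neg_iff.1 h2)) ((neg_lt_neg_iff.1 h1).trans_le (hmM l).2)
    rwa [abs_of_neg (sub_neg.2 h), neg_sub, ← neg_sub_neg]

/-- Weak upper gradients may be truncated to the set where the function is strictly between its
bounds, at the cost of a small multiple of a `p`-integrable function. -/
theorem isUpperGradient_indicator_add {X : Type*} [MetricSpace X] [MeasurableSpace X]
    {u : X → ℝ} {g ρ : X → ℝ≥0∞} {A : Set X} {m M : ℝ} (hg : Measurable g) (hρ : Measurable ρ)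
    (hA : MeasurableSet A)
    (hug : ∀ σ : RectifiableCurve X, ¬ UpperGradientIneq u g σ → lineIntegral ρ σ = ∞)
    (humM : ∀ x, m ≤ u x ∧ u x ≤ M) (huA : ∀ x, m < u x → u x < M → x ∈ A)
    {ε : ℝ≥0∞} (hε : ε ≠ 0) (hε' : ε ≠ ∞) :
    IsUpperGradient u (A.indicator g + fun x => ε * (g + ρ) x) := by
  refine ⟨(hg.indicator hA).add ((hg.add hρ).const_mul ε), fun σ => ?_⟩
  -- If `g + ρ` has infinite integral along `σ`, so does its `ε`-multiple and nothing is left to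
  -- prove.
  by_cases hfin : lineIntegral (g + ρ) σ = ∞
  · have h : lineIntegral (fun x => ε * (g + ρ) x) σ = ∞ := by
      rw [lineIntegral, lintegral_const_mul' _ _ hε']
      exact ENNReal.mul_eq_top.2 (Or.inl ⟨hε, hfin⟩)
    exact le_top.trans (h.symm.le.trans (lineIntegral_mono (fun x => le_add_self) σ))
  · have hG : ∫⁻ x in Icc 0 σ.length, g (σ.toFun x) ≠ ∞ :=
      ne_top_of_le_ne_top hfin (lineIntegral_mono (fun x => le_self_add) σ)
    have hR : ∫⁻ x in Icc 0 σ.length, ρ (σ.toFun x) ≠ ∞ :=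
      ne_top_of_le_ne_top hfin (lineIntegral_mono (fun x => le_add_self) σ)
    have hv : ∀ s t, 0 ≤ s → s < t → t ≤ σ.length →
        ENNReal.ofReal |u (σ.toFun s) - u (σ.toFun t)| ≤ ∫⁻ x in Icc s t, g (σ.toFun x) := by
      -- No subcurve is exceptional: `ρ` would have infinite integral along it, hence along `σ`.
      intro s t hs hst ht
      by_contra hcon
      refine ne_top_of_le_ne_top hR (lintegral_mono_set (Icc_subset_Icc hs ht))
        ((lineIntegral_subcurve ρ σ hs hst ht).symm.trans (hug _ fun h => hcon ?_))
      rw [UpperGradientIneq, lineIntegral_subcurve] at h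
      simpa [RectifiableCurve.subcurve] using h
    refine (increment_le_lintegral_of_between (v := fun t => u (σ.toFun t)) (m := m) (M := M)
      (H := fun t => A.indicator g (σ.toFun t)) σ.length_pos.le
      (continuousOn_of_increment_le_lintegral hG hv) hv (fun x => humM _)
      fun x _ h1 h2 => ?_).trans (lineIntegral_mono (fun x => le_self_add) σ)
    rw [indicator_of_mem (huA _ h1 h2)]

/-- An a.e.-measurable function has a measurable majorant that is a.e. equal to it. -/
theorem exists_measurable_ge_ae_eq {α : Type*} [MeasurableSpace α] {μ : Measure α}
    {g : α → ℝ≥0∞} (hg : AEMeasurable g μ) :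
    ∃ g' : α → ℝ≥0∞, Measurable g' ∧ (∀ x, g x ≤ g' x) ∧ g' =ᵐ[μ] g := by
  classical
  obtain ⟨g₁, hg₁, hae⟩ := hg
  obtain ⟨N, hN, hNm, hN0⟩ := exists_measurable_superset_of_null hae
  refine ⟨N.piecewise (fun _ => ∞) g₁, Measurable.piecewise hNm measurable_const hg₁,
    fun x => ?_, ?_⟩
  · by_cases hx : x ∈ N
    · simp [hx]
    · have : g x = g₁ x := by by_contra h; exact hx (hN h)
      simp [hx, this]
  · filter_upwards [hae, measure_eq_zero_iff_ae_notMem.1 hN0] with x hx hxN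
    simp [hxN, hx]

/-! ### Doubling from annular decay -/

/-- Annular decay implies that some fixed contraction of balls halves the measure at most. -/
theorem exists_contraction_of_annularDecay {η : ℝ} (hη : 0 < η) {C : ℝ} (hC : 1 ≤ C) :
    ∃ θ : ℝ, 0 < θ ∧ θ < 1 ∧ ∀ {X : Type*} [MetricSpace X] [MeasurableSpace X] (μ : Measure X)
      (x : X), (∀ r : ℝ, 0 < r → μ (Metric.ball x r) < ∞) → AnnularDecayAt μ x η C →
      ∀ R : ℝ, 0 < R → μ (Metric.ball x R) ≤ 2 * μ (Metric.ball x (θ * R)) := by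
  have hpos : 0 < 2 * C := by linarith
  have ht0 : 0 < (2 * C) ^ (-(1 / η)) := Real.rpow_pos_of_pos hpos _
  have ht1 : (2 * C) ^ (-(1 / η)) < 1 :=
    Real.rpow_lt_one_of_one_lt_of_neg (by linarith) (by simpa using hη)
  -- With `t = (2C)^(-1/η)`, `C * t ^ η = 1/2`: the annulus between radii `(1 - t)R` and `R` carries
  -- at most half of the mass.
  refine ⟨1 - (2 * C) ^ (-(1 / η)), by linarith, by linarith, ?_⟩
  intro X _ _ μ x hfin hdec R hR
  set t := (2 * C) ^ (-(1 / η)) with ht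
  have htη : C * t ^ η = 1 / 2 := by
    rw [ht, ← Real.rpow_mul hpos.le, neg_mul, one_div_mul_cancel hη.ne', Real.rpow_neg_one]
    field_simp
  have h1 := hdec ((1 - t) * R) R (by nlinarith) (by nlinarith)
  rw [mul_div_cancel_right₀ _ hR.ne', sub_sub_cancel, htη] at h1
  have h2 : μ (Metric.ball x R) ≤ ENNReal.ofReal (1 / 2) * μ (Metric.ball x R)
      + μ (Metric.ball x ((1 - t) * R)) :=
    (measure_le_inter_add_sdiff μ _ (Metric.ball x ((1 - t) * R))).trans
      ((add_comm _ _).le.trans (add_le_add h1 (measure_mono inter_subset_right)))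
  have hf1 := (hfin R hR).ne
  have hf2 := (hfin ((1 - t) * R) (by nlinarith)).ne
  rw [← ENNReal.ofReal_toReal hf1, ← ENNReal.ofReal_toReal hf2] at h2 ⊢
  rw [← ENNReal.ofReal_mul (by norm_num), ← ENNReal.ofReal_add (by positivity) (by positivity),
    ENNReal.ofReal_le_ofReal_iff (by positivity)] at h2
  rw [show (2 : ℝ≥0∞) = ENNReal.ofReal 2 by simp, ← ENNReal.ofReal_mul (by norm_num)]
  exact ENNReal.ofReal_le_ofReal (by linarith)

/-- Annular decay implies doubling. -/
theorem exists_doubling_of_annularDecay {η : ℝ} (hη : 0 < η) (C : ℝ) {τ : ℝ} (hτ : 1 < τ) :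
    ∃ D : ℝ, 0 < D ∧ ∀ {X : Type*} [MetricSpace X] [MeasurableSpace X] (μ : Measure X)
      (x : X), (∀ r : ℝ, 0 < r → μ (Metric.ball x r) < ∞) → AnnularDecayAt μ x η C →
      ∀ R : ℝ, 0 < R → μ (Metric.ball x (τ * R)) ≤ ENNReal.ofReal D * μ (Metric.ball x (R / 2)) := by
  obtain ⟨θ, hθ0, hθ1, hθ⟩ := exists_contraction_of_annularDecay hη (le_max_right C 1)
  -- `n` contractions bring the radius from `τR` to at most `R / 2`, each costing a factor `2`.
  obtain ⟨n, hn⟩ := exists_pow_lt_of_lt_one (show 0 < 1 / (2 * τ) by positivity) hθ1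
  refine ⟨2 ^ n, by positivity, ?_⟩
  intro X _ _ μ x hfin hdec R hR
  have hdec' : AnnularDecayAt μ x η (max C 1) := fun r R hr hrR =>
    (hdec r R hr hrR).trans (mul_le_mul_left (ENNReal.ofReal_le_ofReal
      (mul_le_mul_of_nonneg_right (le_max_left _ _) (Real.rpow_nonneg
        (sub_nonneg.2 ((div_le_one (hr.trans hrR)).2 hrR.le)) _))) _)
  have hiter : ∀ k : ℕ, ∀ R : ℝ, 0 < R →
      μ (Metric.ball x R) ≤ 2 ^ k * μ (Metric.ball x (θ ^ k * R)) := by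
    intro k
    induction k with
    | zero => intro R _; simp
    | succ k ih =>
      intro R hR
      refine (ih R hR).trans ?_
      have := hθ μ x hfin hdec' (θ ^ k * R) (by positivity)
      rw [pow_succ, pow_succ', mul_assoc, mul_assoc]
      exact mul_le_mul_right this _
  refine (hiter n (τ * R) (by positivity)).trans ?_
  rw [ENNReal.ofReal_pow (by norm_num), ENNReal.ofReal_ofNat]
  refine mul_le_mul_right (measure_mono (Metric.ball_subset_ball ?_)) _
  calc θ ^ n * (τ * R) ≤ 1 / (2 * τ) * (τ * R) := by gcongr
    _ = R / 2 := by field_simp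

/-! ### Mean oscillation, Hölder and exponents -/

/-- A lower bound for the mean oscillation of a function which is `1` on `E` and vanishes outside
a set `F` that fills only a fraction of `B`. -/
theorem le_average_abs_sub_average {α : Type*} [MeasurableSpace α] {μ : Measure α}
    {E F B : Set α} (hE : MeasurableSet E) (hF : MeasurableSet F)
    (hEB : E ⊆ B) (hFB : F ⊆ B) (hB0 : μ B ≠ 0) (hBfin : μ B ≠ ∞) {u : α → ℝ}
    (hu : Integrable u μ) (hu1 : ∀ x, u x ≤ 1) (huE : ∀ x ∈ E, u x = 1)
    (huF : ∀ x ∉ F, u x = 0) {κ : ℝ} (hκ : μ.real F ≤ κ * μ.real B) :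
    (1 - κ) * μ.real E / μ.real B ≤ ⨍ y in B, |u y - ⨍ z in B, u z ∂μ| ∂μ := by
  have hBpos : 0 < μ.real B := ENNReal.toReal_pos hB0 hBfin
  set a := ⨍ z in B, u z ∂μ with ha
  have haκ : a ≤ κ := by
    have h1 : ∫ z in B, u z ∂μ ≤ μ.real F := by
      have h2 : ∫ z in B, u z ∂μ ≤ ∫ z in B, F.indicator (fun _ => (1 : ℝ)) z ∂μ := by
        refine setIntegral_mono hu.integrableOn
          ((integrable_indicator_iff hF).2 (integrableOn_const ?_)) fun x => ?_
        · exact ((Measure.restrict_apply_le _ _).trans_lt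
            ((measure_mono hFB).trans_lt hBfin.lt_top)).ne
        · by_cases hx : x ∈ F
          · simpa [hx] using hu1 x
          · simp [hx, huF x hx]
      rwa [setIntegral_indicator hF, inter_eq_right.2 hFB, setIntegral_const, smul_eq_mul,
        mul_one] at h2
    rw [ha, setAverage_eq, smul_eq_mul, inv_mul_le_iff₀ hBpos, mul_comm]
    exact h1.trans hκ
  have hint : IntegrableOn (fun y => |u y - a|) B μ :=
    (hu.integrableOn.sub (integrableOn_const hBfin)).abs
  rw [setAverage_eq, smul_eq_mul, ← div_eq_inv_mul]
  gcongr
  calc (1 - κ) * μ.real E = ∫ y in E, (1 - κ) ∂μ := by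
        rw [setIntegral_const, smul_eq_mul, mul_comm]
    _ ≤ ∫ y in E, |u y - a| ∂μ := by
        refine setIntegral_mono_on (integrableOn_const
          ((measure_mono hEB).trans_lt hBfin.lt_top).ne) (hint.mono_set hEB) hE fun y hy => ?_
        rw [huE y hy]
        exact (by linarith : 1 - κ ≤ 1 - a).trans (le_abs_self _)
    _ ≤ ∫ y in B, |u y - a| ∂μ :=
        setIntegral_mono_set hint (Filter.Eventually.of_forall fun _ => abs_nonneg _)
          hEB.eventuallyLE

/-- Hölder's inequality for two exponents on a set. -/
theorem setLIntegral_rpow_le_rpow_mul_measure {α : Type*} [MeasurableSpace α] {μ : Measure α}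
    {g : α → ℝ≥0∞} (hg : AEMeasurable g μ) {p q : ℝ} (hq : 0 < q) (hqp : q ≤ p) (A : Set α) :
    (∫⁻ x in A, g x ^ q ∂μ) ^ (1 / q)
      ≤ (∫⁻ x in A, g x ^ p ∂μ) ^ (1 / p) * μ A ^ (1 / q - 1 / p) := by
  have h := eLpNorm'_le_eLpNorm'_mul_rpow_measure_univ (μ := μ.restrict A) hq hqp
    hg.restrict.aestronglyMeasurable
  simpa [eLpNorm'] using h

theorem le_mul_of_forall_le_mul_add {K C a b : ℝ≥0∞} (hC : C ≠ ∞) (hb : b ≠ ∞)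
    (h : ∀ ε : ℝ≥0∞, ε ≠ 0 → ε ≠ ∞ → K ≤ C * (a + ε * b)) : K ≤ C * a := by
  have h1 : Filter.Tendsto (fun n : ℕ => C * (a + (n : ℝ≥0∞)⁻¹ * b)) Filter.atTop
      (nhds (C * (a + 0 * b))) :=
    ENNReal.Tendsto.const_mul (tendsto_const_nhds.add
      (ENNReal.Tendsto.mul_const ENNReal.tendsto_inv_nat_nhds_zero (Or.inr hb))) (Or.inr hC)
  rw [zero_mul, add_zero] at h1
  refine ge_of_tendsto h1 ?_
  filter_upwards [Filter.eventually_ne_atTop 0] with n hn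
  exact h _ (by simp) (by simpa using hn)

/-- Solves the final estimate for the energy `e`, with `m` the mass of `B_R` and `K * δ ^ η * m` the
bound for the annulus. The powers of `m` combine to `m^(-1/p)`. -/
theorem mul_le_of_le_mul_rpow {p q η a b K R m δ e : ℝ} (hq : 0 < q) (hqp : q < p)
    (ha : 0 < a) (hb : 0 < b) (hK : 0 < K) (hR : 0 < R) (hm : 0 < m) (hδ : 0 < δ) (he : 0 ≤ e)
    (h : a ≤ b * R * ((m ^ (1 / q))⁻¹ * (e ^ (1 / p) * (K * δ ^ η * m) ^ (1 / q - 1 / p)))) :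
    (a / (b * K ^ (1 / q - 1 / p))) ^ p * δ ^ (η * (q - p) / q) / R ^ p * m ≤ e := by
  have hp : 0 < p := hq.trans hqp
  set s := 1 / q - 1 / p with hs
  have hδs : 0 < δ ^ (η * s) := Real.rpow_pos_of_pos hδ _
  have hmm : (m ^ (1 / q))⁻¹ * m ^ s = (m ^ (1 / p))⁻¹ := by
    rw [← Real.rpow_neg hm.le, ← Real.rpow_add hm, ← Real.rpow_neg hm.le]
    congr 1
    rw [hs]; ring
  have hKs : 0 < K ^ s := Real.rpow_pos_of_pos hK _
  have hmp : 0 < m ^ (1 / p) := Real.rpow_pos_of_pos hm _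
  rw [Real.mul_rpow (by positivity) hm.le, Real.mul_rpow hK.le (by positivity),
    ← Real.rpow_mul hδ.le] at h
  have h2 : a ≤ b * K ^ s * R * δ ^ (η * s) * (m ^ (1 / p))⁻¹ * e ^ (1 / p) := by
    calc a ≤ _ := h
      _ = b * K ^ s * R * δ ^ (η * s) * ((m ^ (1 / q))⁻¹ * m ^ s) * e ^ (1 / p) := by ring
      _ = _ := by rw [hmm]
  have h3 : a / (b * K ^ s) * (δ ^ (η * s))⁻¹ / R * m ^ (1 / p) ≤ e ^ (1 / p) := by
    have h4 : a / (b * K ^ s) * (δ ^ (η * s))⁻¹ / R * m ^ (1 / p)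
        = a / (b * K ^ s * R * δ ^ (η * s) * (m ^ (1 / p))⁻¹) := by field_simp
    rw [h4, div_le_iff₀ (by positivity), mul_comm]
    exact h2
  have h5 := Real.rpow_le_rpow (by positivity) h3 hp.le
  rw [← Real.rpow_mul he, one_div_mul_cancel hp.ne', Real.rpow_one,
    Real.mul_rpow (by positivity) (by positivity), ← Real.rpow_mul hm.le,
    one_div_mul_cancel hp.ne', Real.rpow_one, Real.div_rpow (by positivity) hR.le,
    Real.mul_rpow (by positivity) (by positivity), ← Real.rpow_neg hδ.le,
    ← Real.rpow_mul hδ.le] at h5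
  convert h5 using 5
  rw [hs]
  field_simp
  ring

/-! ### Admissible functions and the localized Poincaré inequality -/

theorem IsAdmissible.mem_Icc {X : Type*} [MetricSpace X] [MeasurableSpace X] {μ : Measure X}
    {p : ℝ} {E Ω : Set X} {u : X → ℝ} (hu : IsAdmissible μ p E Ω u) (x : X) :
    0 ≤ u x ∧ u x ≤ 1 := by
  by_cases hx : x ∈ Ω
  · exact ⟨(indicator_nonneg (fun _ _ => zero_le_one) x).trans (hu.2.1 x hx).1, (hu.2.1 x hx).2⟩
  · simp [hu.2.2 x hx]

theorem IsAdmissible.eq_one {X : Type*} [MetricSpace X] [MeasurableSpace X] {μ : Measure X}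
    {p : ℝ} {E Ω : Set X} {u : X → ℝ} (hu : IsAdmissible μ p E Ω u) {x : X} (hx : x ∈ E)
    (hxΩ : x ∈ Ω) : u x = 1 := by
  have h := hu.2.1 x hxΩ
  rw [indicator_of_mem hx] at h
  exact le_antisymm h.2 h.1

theorem IsAdmissible.integrable {X : Type*} [MetricSpace X] [MeasurableSpace X] {μ : Measure X}
    {p : ℝ} {E Ω : Set X} {u : X → ℝ} (hu : IsAdmissible μ p E Ω u) (hΩ : MeasurableSet Ω)
    (hfin : μ Ω ≠ ∞) : Integrable u μ := by
  refine Integrable.mono' ((integrable_indicator_iff hΩ).2 (integrableOn_const (C := (1 : ℝ)) hfin))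
    hu.1.1.aestronglyMeasurable (Filter.Eventually.of_forall fun x => ?_)
  rw [Real.norm_eq_abs, abs_of_nonneg (hu.mem_Icc x).1]
  by_cases hx : x ∈ Ω
  · simpa [hx] using (hu.mem_Icc x).2
  · simp [hx, hu.2.2 x hx]

/-- A `q`-Poincaré inequality at `x`, applied to a function that is constant outside `A`, only sees
its weak upper gradients on `A`. -/
theorem PoincareAt.average_le {X : Type*} [MetricSpace X] [MeasurableSpace X] [BorelSpace X]
    {μ : Measure X} {x₀ : X} {p q C lam : ℝ} (hq : 1 ≤ q) (hqp : q < p) (hlam : 1 ≤ lam)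
    (hP : PoincareAt μ x₀ q C lam)
    (hball : ∀ r : ℝ, 0 < r → 0 < μ (Metric.ball x₀ r) ∧ μ (Metric.ball x₀ r) < ∞)
    {u : X → ℝ} (hu : Integrable u μ) (hu01 : ∀ x, 0 ≤ u x ∧ u x ≤ 1)
    {A : Set X} (hA : MeasurableSet A) (huA : ∀ x, 0 < u x → u x < 1 → x ∈ A)
    {g : X → ℝ≥0∞} (hg : IsWeakUpperGradient μ p u g) (hgp : ∫⁻ x, g x ^ p ∂μ < ∞)
    {ρ : ℝ} (hρ : 0 < ρ) :
    ENNReal.ofReal (⨍ y in Metric.ball x₀ ρ, |u y - ⨍ z in Metric.ball x₀ ρ, u z ∂μ| ∂μ)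
      ≤ ENNReal.ofReal (C * ρ) * ((μ (Metric.ball x₀ ρ) ^ (1 / q))⁻¹ *
        ((∫⁻ x in A, g x ^ p ∂μ) ^ (1 / p) * μ A ^ (1 / q - 1 / p))) := by
  have hq0 : 0 < q := by linarith
  have hp1 : 1 ≤ p := by linarith
  obtain ⟨g', hg'm, hgg', hg'g⟩ := exists_measurable_ge_ae_eq hg.1
  obtain ⟨w, hwm, hwp, hw⟩ := hg.2
  have hg'p : ∫⁻ x, g' x ^ p ∂μ < ∞ := by
    rwa [lintegral_congr_ae (hg'g.mono fun x hx => by rw [hx])]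
  have hhp : ∫⁻ x, (g' + w) x ^ p ∂μ < ∞ :=
    ENNReal.lintegral_rpow_add_lt_top_of_lintegral_rpow_lt_top hg'm.aemeasurable hg'p hwp hp1
  set B := Metric.ball x₀ ρ with hB
  set B' := Metric.ball x₀ (lam * ρ) with hB'
  have hρ' : 0 < lam * ρ := by positivity
  have hBB' : μ B ≤ μ B' := measure_mono (Metric.ball_subset_ball (by nlinarith))
  have hBq0 : μ B ^ (1 / q) ≠ 0 :=
    (ENNReal.rpow_pos (hball ρ hρ).1 (hball ρ hρ).2.ne).ne'
  -- Hölder on the finite-measure ball `B'` makes the coefficient of `ε` finite, as the limit `ε →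
  -- 0` needs.
  have hhq : (∫⁻ x in B', (g' + w) x ^ q ∂μ) ^ (1 / q) ≠ ∞ := by
    refine ne_top_of_le_ne_top ?_ (setLIntegral_rpow_le_rpow_mul_measure
      (hg'm.add hwm).aemeasurable hq0 hqp.le B')
    refine ENNReal.mul_ne_top (ENNReal.rpow_ne_top_of_nonneg (by positivity) ?_)
      (ENNReal.rpow_ne_top_of_nonneg ?_ (hball _ hρ').2.ne)
    · exact ((setLIntegral_le_lintegral _ _).trans_lt hhp).ne
    · exact sub_nonneg.2 (one_div_le_one_div_of_le hq0 hqp.le)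
  have hmain : ∀ ε : ℝ≥0∞, ε ≠ 0 → ε ≠ ∞ →
      ENNReal.ofReal (⨍ y in B, |u y - ⨍ z in B, u z ∂μ| ∂μ)
      ≤ (ENNReal.ofReal (C * ρ) * (μ B ^ (1 / q))⁻¹) * ((∫⁻ x in A, g' x ^ q ∂μ) ^ (1 / q)
        + ε * (∫⁻ x in B', (g' + w) x ^ q ∂μ) ^ (1 / q)) := by
    intro ε hε hε'
    have hub : IsUpperGradient u (A.indicator g' + fun x => ε * (g' + w) x) := by
      refine isUpperGradient_indicator_add hg'm hwm hA (fun σ hσ => hw σ fun h => hσ ?_)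
        hu01 huA hε hε'
      exact h.trans (lineIntegral_mono hgg' σ)
    refine (hP ρ hρ u _ hu hub).trans ?_
    rw [mul_assoc]
    refine mul_le_mul_right ?_ _
    rw [setLAverage_eq, ENNReal.div_rpow_of_nonneg _ _ (by positivity), ENNReal.div_eq_inv_mul]
    -- Normalizing by the smaller `μ B` and dropping `B'` from the integral over `A` removes `lam`
    -- from the bound.
    refine mul_le_mul' (ENNReal.inv_le_inv.2 (ENNReal.rpow_le_rpow hBB' (by positivity))) ?_
    refine (ENNReal.lintegral_Lp_add_le (hg'm.indicator hA).aemeasurable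
      ((hg'm.add hwm).const_mul ε).aemeasurable hq).trans (add_le_add ?_ (le_of_eq ?_))
    · refine ENNReal.rpow_le_rpow ((setLIntegral_le_lintegral _ _).trans ?_) (by positivity)
      rw [← lintegral_indicator hA]
      refine lintegral_mono fun x => ?_
      by_cases hx : x ∈ A
      · simp [hx]
      · simp [hx, hq0]
    · simp_rw [ENNReal.mul_rpow_of_nonneg _ _ hq0.le]
      rw [lintegral_const_mul' _ _ (ENNReal.rpow_ne_top_of_nonneg hq0.le hε'),
        ENNReal.mul_rpow_of_nonneg _ _ (by positivity), ← ENNReal.rpow_mul,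
        mul_one_div_cancel hq0.ne', ENNReal.rpow_one]
  refine (le_mul_of_forall_le_mul_add (ENNReal.mul_ne_top ENNReal.ofReal_ne_top
    (ENNReal.inv_ne_top.2 hBq0)) hhq hmain).trans ?_
  rw [mul_assoc]
  refine mul_le_mul_right (mul_le_mul_right ?_ _) _
  refine (setLIntegral_rpow_le_rpow_mul_measure hg'm.aemeasurable hq0 hqp.le A).trans
    (le_of_eq ?_)
  rw [lintegral_congr_ae ((ae_restrict_of_ae hg'g).mono fun x hx => by rw [hx])]

end ThinAnnuli

/-! ### The capacity estimate -/

theorem mainTheorem4 (p q η CA CP lam τ γ : ℝ) (hq : 1 ≤ q) (hqp : q < p) (hη : 0 < η)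
    (hCP : 0 < CP) (hlam : 1 ≤ lam) (hτ : 1 < τ) (hγ : 1 < γ) :
    ∃ c : ℝ, 0 < c ∧
      ∀ (X : Type*) [MetricSpace X] [MeasurableSpace X] [BorelSpace X] (μ : Measure X),
        (∀ (x : X) (r : ℝ), 0 < r → 0 < μ (Metric.ball x r) ∧ μ (Metric.ball x r) < ∞) →
        ∀ x₀ : X,
          ThinAnnuli.PoincareAt μ x₀ q CP lam →
          ThinAnnuli.AnnularDecayAt μ x₀ η CA →
          ThinAnnuli.ReverseDoublingAt μ x₀ τ γ →
          ∀ r R : ℝ, 0 < R / 2 → R / 2 ≤ r → r < R →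
            ENNReal.ofReal R ≤ Metric.ediam (univ : Set X) / ENNReal.ofReal (2 * τ) →
            ENNReal.ofReal (c * (1 - r / R) ^ (η * (q - p) / q) / R ^ p)
                * μ (Metric.ball x₀ R)
              ≤ ThinAnnuli.variationalCapacity μ p (Metric.ball x₀ r) (Metric.ball x₀ R) := by
  obtain ⟨D, hD, hdoub⟩ := ThinAnnuli.exists_doubling_of_annularDecay hη CA hτ
  have hq0 : 0 < q := by linarith
  have hp0 : 0 < p := by linarith
  have hκ : 0 < 1 - 1 / γ := by
    rw [sub_pos, div_lt_one (by linarith)]; exact hγ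
  -- `(1 - 1/γ)/D` bounds the oscillation below, `CP * τ` comes from Poincaré at radius `τR`, and
  -- `max CA 1` keeps the annular constant positive.
  refine ⟨((1 - 1 / γ) / D / (CP * τ * max CA 1 ^ (1 / q - 1 / p))) ^ p, by positivity, ?_⟩
  intro X _ _ _ μ hball x₀ hP hdec hrev r R hR2 hRr hrR hdiam
  have hR : 0 < R := by linarith
  have hr : 0 < r := by linarith
  refine le_iInf₂ fun u hu => le_iInf₂ fun g hg => ?_
  have hs : 0 ≤ 1 / q - 1 / p := sub_nonneg.2 (one_div_le_one_div_of_le hq0 hqp.le)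
  have hδ : 0 < 1 - r / R := sub_pos.2 ((div_lt_one hR).2 hrR)
  have hτR : 0 < τ * R := by positivity
  have hRτ : R ≤ τ * R := by nlinarith
  have hsub : Metric.ball x₀ r ⊆ Metric.ball x₀ R := Metric.ball_subset_ball hrR.le
  have hsub' : Metric.ball x₀ R ⊆ Metric.ball x₀ (τ * R) := Metric.ball_subset_ball hRτ
  have hmfin := (hball x₀ R hR).2.ne
  have hMfin := (hball x₀ (τ * R) hτR).2.ne
  have hm : 0 < μ.real (Metric.ball x₀ R) := ENNReal.toReal_pos (hball x₀ R hR).1.ne' hmfin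
  have hM : 0 < μ.real (Metric.ball x₀ (τ * R)) :=
    ENNReal.toReal_pos (hball x₀ _ hτR).1.ne' hMfin
  have hui := hu.integrable Metric.isOpen_ball.measurableSet hmfin
  have hF : μ.real (Metric.ball x₀ R) ≤ 1 / γ * μ.real (Metric.ball x₀ (τ * R)) := by
    have h := ENNReal.toReal_mono hMfin (hrev R hR hdiam)
    rw [ENNReal.toReal_mul, ENNReal.toReal_ofReal (by linarith)] at h
    rw [one_div_mul_eq_div, le_div_iff₀ (by linarith), mul_comm]
    exact h
  have hdoub' : μ.real (Metric.ball x₀ (τ * R)) ≤ D * μ.real (Metric.ball x₀ r) := by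
    have h := (hdoub μ x₀ (fun r hr => (hball x₀ r hr).2) hdec R hR).trans
      (mul_le_mul_right (measure_mono (Metric.ball_subset_ball hRr)) _)
    have h := ENNReal.toReal_mono (ENNReal.mul_ne_top ENNReal.ofReal_ne_top
      (hball x₀ r hr).2.ne) h
    rwa [ENNReal.toReal_mul, ENNReal.toReal_ofReal hD.le] at h
  have hlow := ThinAnnuli.le_average_abs_sub_average (μ := μ)
    (Metric.isOpen_ball (x := x₀) (ε := r)).measurableSet
    (Metric.isOpen_ball (x := x₀) (ε := R)).measurableSet (hsub.trans hsub') hsub'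
    (hball x₀ _ hτR).1.ne' hMfin hui (fun x => (hu.mem_Icc x).2)
    (fun x hx => hu.eq_one hx (hsub hx)) hu.2.2 hF
  have hlow' : (1 - 1 / γ) / D ≤ (1 - 1 / γ) * μ.real (Metric.ball x₀ r)
      / μ.real (Metric.ball x₀ (τ * R)) := by
    rw [div_le_div_iff₀ hD hM, mul_assoc, mul_comm _ D]
    exact mul_le_mul_of_nonneg_left hdoub' hκ.le
  have hpoin := hP.average_le hq hqp hlam (hball x₀) hui hu.mem_Icc
    ((Metric.isOpen_ball (x := x₀) (ε := R)).measurableSet.diff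
      (Metric.isOpen_ball (x := x₀) (ε := r)).measurableSet)
    (fun x h0 h1 => ⟨by by_contra h; exact h0.ne' (hu.2.2 x h),
      fun h => h1.ne (hu.eq_one h (hsub h))⟩) hg.1 hg.2 hτR
  have hE : ∫⁻ x in Metric.ball x₀ R, g x ^ p ∂μ ≠ ∞ :=
    ((setLIntegral_le_lintegral _ _).trans_lt hg.2).ne
  have hann : μ (Metric.ball x₀ R \ Metric.ball x₀ r)
      ≤ ENNReal.ofReal (max CA 1 * (1 - r / R) ^ η * μ.real (Metric.ball x₀ R)) := by
    refine (hdec r R hr hrR).trans ?_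
    rw [ENNReal.ofReal_mul (p := max CA 1 * (1 - r / R) ^ η) (by positivity), Measure.real,
      ENNReal.ofReal_toReal hmfin]
    gcongr
    exact le_max_left _ _
  set e := (∫⁻ x in Metric.ball x₀ R, g x ^ p ∂μ).toReal
  set m := μ.real (Metric.ball x₀ R)
  have hfinal : (1 - 1 / γ) / D ≤ CP * τ * R * ((m ^ (1 / q))⁻¹ * (e ^ (1 / p) *
      (max CA 1 * (1 - r / R) ^ η * m) ^ (1 / q - 1 / p))) := by
    rw [← ENNReal.ofReal_le_ofReal_iff (by positivity)]
    refine (ENNReal.ofReal_le_ofReal (hlow'.trans hlow)).trans (hpoin.trans ?_)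
    rw [← mul_assoc CP, ENNReal.ofReal_mul (p := CP * τ * R) (by positivity),
      ENNReal.ofReal_mul (p := (m ^ (1 / q))⁻¹) (by positivity),
      ENNReal.ofReal_mul (p := e ^ (1 / p)) (by positivity),
      ENNReal.ofReal_inv_of_pos (by positivity), ← ENNReal.ofReal_rpow_of_pos hm,
      ← ENNReal.ofReal_rpow_of_nonneg ENNReal.toReal_nonneg (by positivity),
      ← ENNReal.ofReal_rpow_of_nonneg (by positivity) hs, ENNReal.ofReal_toReal hE,
      show ENNReal.ofReal m = μ (Metric.ball x₀ R) from ENNReal.ofReal_toReal hmfin]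
    -- `μ(B_{τR})` is replaced by the smaller `μ(B_R)` in the inverse, and the energy on the annulus
    -- by that on `B_R`.
    refine mul_le_mul_right (mul_le_mul' (ENNReal.inv_le_inv.2 (ENNReal.rpow_le_rpow
      (measure_mono hsub') (by positivity))) (mul_le_mul' (ENNReal.rpow_le_rpow
      (lintegral_mono_set sdiff_subset) (by positivity)) (ENNReal.rpow_le_rpow hann hs))) _
  have hreal := ThinAnnuli.mul_le_of_le_mul_rpow hq0 hqp (by positivity) (by positivity)
    (by positivity) hR hm hδ ENNReal.toReal_nonneg hfinal
  rw [← ENNReal.ofReal_toReal hmfin, ← ENNReal.ofReal_mul (by positivity),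
    ← ENNReal.ofReal_toReal hE]
  exact ENNReal.ofReal_le_ofReal hreal
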